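/- **Setting.** A process graph consists of a set of states, a transition relation with labels in $\mathcal A\cup\{\tau\}$, an initial state and a set of final states. Write $t\Rightarrow t'$ if $t'$ is reached from $t$ by finitely many $\tau$-steps, and $t\xrightarrow{(a)}t'$ if $t\xrightarrow{a}t'$, or $a=\tau$ and $t=t'$. Two process graphs are *branching bisimilar*, $\leftrightarrow_b$, if their initial states are related by a symmetric relation $R$ on the disjoint union of their states such that, whenever $s\,R\,t$: (1) if $s\xrightarrow{a}s'$ with $a\in\mathcal A\cup\{\tau\}$, then there are $t'',t'$ with $t\Rightarrow t''\xrightarrow{(a)}t'$, $s\,R\,t''$ and $s'\,R\,t'$; (2) if $s$ is final, then $t\Rightarrow t'$ for some final $t'$. A process graph is *executable* if it is branching bisimilar to the process graph of a reactive Turing machine, i.e. a machine with finite sets of states, tape symbols, actions and transitions $s\xrightarrow{a[d/e]T}t$ ($a$ an action or $\tau$; $d,e$ tape symbols or blank; $T\in\{L,R\}$), whose configurations are pairs of a state and a two-way infinite tape with head (initially blank), final if the state is final. A process is *regular* if it has a process graph with finitely many states and transitions. The actions are basic actions together with, for each port $c\in\mathcal C$ and each $m\in\mathbb D\cup\{\varepsilon\}$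 (where $\mathbb D$ is an infinite supply of data), $c!m$ (send), $c?m$ (receive) and $c(m)$ (communicate). In the parallel composition $p\parallel q$ the components interleave their steps, and $c!m$ of one component and $c?m$ of the other may synchronise to $c(m)$; a state is final iff both components are. $\partial_{io}$ blocks all actions $c!m$, $c?m$ with $c\in\{i,o\}$, and $\tau_{\mathcal C}$ turns all $c(m)$, $c\in\mathcal C$, into $\tau$. Let $i\ne o$ be ports. For a finite nonempty $\mathcal D\subseteq\mathbb D$, $Q^{io}$ denotes one of the following: (a) the process graph of the one-state queue automaton with final state, data set $\mathcal D$ and transitions $i?d[*/d]$, $o!d[d/\varepsilon]$ ($d\in\mathcal D$), $o!\varepsilon[\varepsilon/\varepsilon]$. So its states are the strings $\delta\in\mathcal D^*$, initially $\varepsilon$ and all final, and its steps are $\zeta\xrightarrow{i?d}d\zeta$, $\zeta d\xrightarrow{o!d}\zeta$ and $\varepsilon\xrightarrow{o!\varepsilon}\varepsilon$; (b) the process graph of the identifier $Q^{io}$ in the BCP$_\tau$ specification, with an auxiliary port $\ell\neq i,o$, of six equations $$Q^{ab}\;=\;\mathbf 1+b!\varepsilon.Q^{ab}+\sum_{d\in\mathcal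 D}a?d.\,\tau_{\mathcal C}\big(\partial_{c}(Q^{ac}\parallel(\mathbf 1+b!d.Q^{cb}))\big),\qquad\{a,b,c\}=\{i,o,\ell\},$$ with the standard operational semantics. **Theorem.** Let $p$ be an executable process graph such that no transition from a state reachable from its initial state is labelled by a send or receive action at port $i$ or $o$, or by a communication $c(m)$. Then, for each of the choices (a) and (b) of $Q^{io}$ (in (b), for each port $\ell\ne i,o$), there are a finite nonempty data set $\mathcal D\subseteq\mathbb D$ and a regular process, given by a process graph $q$ with finitely many states and transitions, such that $$p\;\leftrightarrow_b\;\tau_{\mathcal C}\big(\partial_{io}(q\parallel Q^{io})\big).$$ -/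

import Mathlib

namespace QueueTheory

universe u v w

/-! ### Labelled transition systems, process graphs, branching bisimilarity

A label in `Option L` is an action `some a` with `a : L`, or the silent action `τ = none`. -/

/-- A process graph with state set `S` and actions from `L`. -/
structure ProcessGraph (S : Type u) (L : Type v) where
  step : S → Option L → S → Prop
  root : S
  final : S → Prop

namespace ProcessGraph

variable {S : Type u} {T : Type w} {L : Type v}

/-- Finitely many (possibly zero) `τ`-steps from `s` to `t`. -/
def TauSteps (G : ProcessGraph S L) : S → S → Prop :=
  Relation.ReflTransGen fun s t => G.step s none t

/-- `t` can be reached from `s` by finitely many steps with arbitrary labels. -/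
def Reachable (G : ProcessGraph S L) : S → S → Prop :=
  Relation.ReflTransGen fun s t => ∃ a, G.step s a t

/-- An `a`-step, or no step at all in case `a = τ`. -/
def OptStep (G : ProcessGraph S L) (s : S) (a : Option L) (t : S) : Prop :=
  G.step s a t ∨ (a = none ∧ s = t)

/-- The transfer conditions of a branching bisimulation, from left to right. -/
structure Transfer (G : ProcessGraph S L) (H : ProcessGraph T L) (R : S → T → Prop) : Prop where
  step : ∀ s t, R s t → ∀ a s', G.step s a s' →
    ∃ t'' t', H.TauSteps t t'' ∧ H.OptStep t'' a t' ∧ R s t'' ∧ R s' t'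
  final : ∀ s t, R s t → G.final s → ∃ t', H.TauSteps t t' ∧ H.final t'

/-- Branching bisimilarity of process graphs: the roots are related by a branching bisimulation
on the disjoint union (a symmetric relation there is given by its part between `S` and `T`). -/
def BranchingBisimilar (G : ProcessGraph S L) (H : ProcessGraph T L) : Prop :=
  ∃ R : S → T → Prop, Transfer G H R ∧ Transfer H G (fun t s => R s t) ∧ R G.root H.root

/-- Finitely many states and finitely many transitions: such a graph represents a regular
process. -/
def IsFinite (G : ProcessGraph S L) : Prop :=
  Finite S ∧ {x : S × Option L × S | G.step x.1 x.2.1 x.2.2}.Finite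

end ProcessGraph

/-! ### Reactive Turing machines and executable processes -/

/-- A reactive Turing machine with states `S`, data `D` and an action alphabet in `L`.
Tape symbols are `Option D`, where `none` is the blank. A transition `(s, a, d, e, m, t)`:
in state `s`, reading `d`, do `a`, write `e`, move the head in direction `m`, go to `t`. -/
structure RTM (S : Type u) (L : Type v) (D : Type w) where
  finite_states : Finite S
  finite_data : Finite D
  nonempty_data : Nonempty D
  alphabet : Set L
  finite_alphabet : alphabet.Finite
  nonempty_alphabet : alphabet.Nonempty
  trans : Set (S × Option L × Option D × Option D × Turing.Dir × S)
  finite_trans : trans.Finite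
  label_mem : ∀ s a d e m t, (s, some a, d, e, m, t) ∈ trans → a ∈ alphabet
  root : S
  final : Set S

/-- The process graph of a reactive Turing machine. `Turing.Tape` is a two-way infinite tape
with a head, containing finitely many non-blank symbols. -/
def RTM.graph {S : Type u} {L : Type v} {D : Type w} (M : RTM S L D) :
    ProcessGraph (S × Turing.Tape (Option D)) L where
  step c a c' := ∃ e m, (c.1, a, c.2.head, e, m, c'.1) ∈ M.trans ∧ c'.2 = (c.2.write e).move m
  root := (M.root, default)
  final c := c.1 ∈ M.final

/-- A process graph is executable if it is branching bisimilar to that of some RTM. -/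
def ProcessGraph.IsExecutable {S : Type u} {L : Type v} (G : ProcessGraph S L) : Prop :=
  ∃ (S' D : Type) (M : RTM S' L D), G.BranchingBisimilar M.graph

/-! ### Queue automata -/

/-- The condition on the queue in a transition. -/
inductive QueueTest (D : Type u) where
  /-- the head of the queue is `d`, which is dequeued -/
  | deq (d : D)
  /-- the queue is empty -/
  | empty
  /-- the queue is arbitrary, and nothing is dequeued -/
  | star

/-- A queue automaton with states `S`, data `D` and an action alphabet in `L`. In a transition
`(s, a, x, δ, t)`, `x` is the test on the queue, and `δ` is the string that is enqueued. -/
structure QueueAutomaton (S : Type u) (L : Type v) (D : Type w) where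
  finite_states : Finite S
  finite_data : Finite D
  nonempty_data : Nonempty D
  alphabet : Set L
  finite_alphabet : alphabet.Finite
  nonempty_alphabet : alphabet.Nonempty
  trans : Set (S × Option L × QueueTest D × List D × S)
  finite_trans : trans.Finite
  label_mem : ∀ s a x δ t, (s, some a, x, δ, t) ∈ trans → a ∈ alphabet
  root : S
  final : Set S

/-- Steps of a queue automaton. The head of the queue is the last element of the list;
strings are enqueued at the front of the list. -/
inductive QueueAutomaton.Step {S : Type u} {L : Type v} {D : Type w} (Q : QueueAutomaton S L D) :
    S × List D → Option L → S × List D → Prop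
  | empty {s a δ t} : (s, a, QueueTest.empty, δ, t) ∈ Q.trans → Step Q (s, []) a (t, δ)
  | deq {s a d δ t} (ζ : List D) : (s, a, QueueTest.deq d, δ, t) ∈ Q.trans →
      Step Q (s, ζ ++ [d]) a (t, δ ++ ζ)
  | star {s a δ t} (ζ : List D) : (s, a, QueueTest.star, δ, t) ∈ Q.trans →
      Step Q (s, ζ) a (t, δ ++ ζ)

/-- The process graph of a queue automaton. -/
def QueueAutomaton.graph {S : Type u} {L : Type v} {D : Type w} (Q : QueueAutomaton S L D) :
    ProcessGraph (S × List D) L where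
  step := Q.Step
  root := (Q.root, [])
  final c := c.1 ∈ Q.final

/-! ### Communication -/

/-- Actions: basic actions from `A`, and for each port `c : C` and message `m : M` the actions
`c!m` (send), `c?m` (receive), `c(m)` (communicate). -/
inductive Act (A : Type u) (C : Type v) (M : Type w) where
  | base (a : A)
  | send (c : C) (m : M)
  | recv (c : C) (m : M)
  | comm (c : C) (m : M)

/-- The action is neither a send or receive action at port `i` or `o`, nor a communication. -/
def Act.Avoids {A : Type u} {C : Type v} {M : Type w} (i o : C) : Act A C M → Prop
  | base _ => True
  | send c _ => c ≠ i ∧ c ≠ o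
  | recv c _ => c ≠ i ∧ c ≠ o
  | comm _ _ => False

section Operators

variable {A : Type*} {C : Type*} {M : Type*} {S : Type*} {T : Type*}

/-- Steps of the parallel composition of two process graphs. -/
inductive ProcessGraph.ParStep (G : ProcessGraph S (Act A C M)) (H : ProcessGraph T (Act A C M)) :
    S × T → Option (Act A C M) → S × T → Prop
  | left {s a s'} (t) : G.step s a s' → ParStep G H (s, t) a (s', t)
  | right {t a t'} (s) : H.step t a t' → ParStep G H (s, t) a (s, t')
  | sendRecv {s s' t t' c m} : G.step s (some (.send c m)) s' → H.step t (some (.recv c m)) t' →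
      ParStep G H (s, t) (some (.comm c m)) (s', t')
  | recvSend {s s' t t' c m} : G.step s (some (.recv c m)) s' → H.step t (some (.send c m)) t' →
      ParStep G H (s, t) (some (.comm c m)) (s', t')

/-- Parallel composition `G ∥ H`. -/
def ProcessGraph.par (G : ProcessGraph S (Act A C M)) (H : ProcessGraph T (Act A C M)) :
    ProcessGraph (S × T) (Act A C M) where
  step := ParStep G H
  root := (G.root, H.root)
  final x := G.final x.1 ∧ H.final x.2

/-- Encapsulation `∂_c`: the actions `c!m` and `c?m` are blocked. -/
def ProcessGraph.encap (c : C) (G : ProcessGraph S (Act A C M)) : ProcessGraph S (Act A C M) where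
  step s a t := G.step s a t ∧ ∀ m, a ≠ some (.send c m) ∧ a ≠ some (.recv c m)
  root := G.root
  final := G.final

/-- Abstraction `τ_C`: all communications `c(m)` are turned into `τ`. -/
def ProcessGraph.hide (G : ProcessGraph S (Act A C M)) : ProcessGraph S (Act A C M) where
  step s a t := (G.step s a t ∧ ∀ c m, a ≠ some (.comm c m)) ∨
    (a = none ∧ ∃ c m, G.step s (some (.comm c m)) t)
  root := G.root
  final := G.final

end Operators

/-! ### The process algebra BCP with abstraction and standard communication -/

/-- Process expressions, with process identifiers from `X`. -/
inductive BCP (A C M X : Type*) where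
  | deadlock
  | emp
  | var (x : X)
  | pre (a : Option (Act A C M)) (p : BCP A C M X)
  | alt (p q : BCP A C M X)
  | par (p q : BCP A C M X)
  | encap (c : C) (p : BCP A C M X)
  | hide (p : BCP A C M X)

namespace BCP

variable {A C M X : Type*}

/-- The acceptance predicate on expressions, given a recursive specification `Γ`. -/
inductive Final (Γ : X → BCP A C M X) : BCP A C M X → Prop
  | emp : Final Γ emp
  | altLeft {p} (q) : Final Γ p → Final Γ (alt p q)
  | altRight {q} (p) : Final Γ q → Final Γ (alt p q)
  | par {p q} : Final Γ p → Final Γ q → Final Γ (par p q)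
  | encap {p} (c) : Final Γ p → Final Γ (encap c p)
  | hide {p} : Final Γ p → Final Γ (hide p)
  | var {x} : Final Γ (Γ x) → Final Γ (var x)

/-- The transition relation on expressions, given a recursive specification `Γ`. -/
inductive Step (Γ : X → BCP A C M X) :
    BCP A C M X → Option (Act A C M) → BCP A C M X → Prop
  | pre (a p) : Step Γ (pre a p) a p
  | altLeft {p a p'} (q) : Step Γ p a p' → Step Γ (alt p q) a p'
  | altRight {q a q'} (p) : Step Γ q a q' → Step Γ (alt p q) a q'
  | parLeft {p a p'} (q) : Step Γ p a p' → Step Γ (par p q) a (par p' q)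
  | parRight {q a q'} (p) : Step Γ q a q' → Step Γ (par p q) a (par p q')
  | sendRecv {p p' q q' c m} : Step Γ p (some (.send c m)) p' → Step Γ q (some (.recv c m)) q' →
      Step Γ (par p q) (some (.comm c m)) (par p' q')
  | recvSend {p p' q q' c m} : Step Γ p (some (.recv c m)) p' → Step Γ q (some (.send c m)) q' →
      Step Γ (par p q) (some (.comm c m)) (par p' q')
  | encap {p a p' c} : Step Γ p a p' →
      (∀ m, a ≠ some (.send c m) ∧ a ≠ some (.recv c m)) → Step Γ (encap c p) a (encap c p')
  | hideComm {p p' c m} : Step Γ p (some (.comm c m)) p' → Step Γ (hide p) none (hide p')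
  | hideOther {p a p'} : Step Γ p a p' → (∀ c m, a ≠ some (.comm c m)) →
      Step Γ (hide p) a (hide p')
  | var {x a p'} : Step Γ (Γ x) a p' → Step Γ (var x) a p'

/-- The process graph of an expression. -/
def graph (Γ : X → BCP A C M X) (p : BCP A C M X) :
    ProcessGraph (BCP A C M X) (Act A C M) where
  step := Step Γ
  root := p
  final := Final Γ

/-- The sum `p₁ + (p₂ + ⋯ + (pₙ + 0))`. -/
def sum (l : List (BCP A C M X)) : BCP A C M X := l.foldr alt deadlock

end BCP

/-! ### The queue

Messages are elements of `Option 𝔻`: either a datum `some d`, or `none`, the message `ε`, which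
signals that the queue is empty. The queue is over a finite set `Δ` of data. -/

section Queue

variable {A : Type*} {C : Type*} {𝔻 : Type*}

/-- The transitions of the queue: `i?d[*/d]`, `o!d[d/ε]` for `d ∈ Δ`, and `o!ε[ε/ε]`. -/
def queueTrans (i o : C) (Δ : Finset 𝔻) :
    Set (Unit × Option (Act A C (Option 𝔻)) × QueueTest Δ × List Δ × Unit) :=
  Set.range (fun d : Δ => ((), some (.recv i (some d.1)), .star, [d], ())) ∪
  Set.range (fun d : Δ => ((), some (.send o (some d.1)), .deq d, [], ())) ∪
  {((), some (.send o none), .empty, [], ())}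

/-- The queue automaton of the (always terminating) queue with input port `i`, output port `o`
and data set `Δ`. -/
def queueAutomaton (A : Type*) {C : Type*} {𝔻 : Type*} (i o : C) (Δ : Finset 𝔻)
    (hΔ : Δ.Nonempty) : QueueAutomaton Unit (Act A C (Option 𝔻)) Δ where
  finite_states := inferInstance
  finite_data := inferInstance
  nonempty_data := hΔ.to_subtype
  alphabet := Set.range (fun d : Δ => .recv i (some d.1)) ∪
    Set.range (fun d : Δ => .send o (some d.1)) ∪ {.send o none}
  finite_alphabet := ((Set.finite_range _).union (Set.finite_range _)).union (Set.finite_singleton _)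
  nonempty_alphabet := ⟨.send o none, Or.inr rfl⟩
  trans := queueTrans i o Δ
  finite_trans := ((Set.finite_range _).union (Set.finite_range _)).union (Set.finite_singleton _)
  label_mem := by
    rintro s a x δ t ((⟨d, h⟩ | ⟨d, h⟩) | h)
    · simp only [Prod.mk.injEq, Option.some.injEq] at h
      exact Or.inl (Or.inl ⟨d, h.2.1⟩)
    · simp only [Prod.mk.injEq, Option.some.injEq] at h
      exact Or.inl (Or.inr ⟨d, h.2.1⟩)
    · simp only [Set.mem_singleton_iff, Prod.mk.injEq, Option.some.injEq] at h
      exact Or.inr h.2.1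
  root := ()
  final := Set.univ

/-- The six process identifiers of the queue specification. -/
inductive QueueVar where
  | io | il | lo | ol | li | oi

/-- The right-hand side of the equation of the identifier `x = Q^{ab}`:
`1 + b!ε.Q^{ab} + Σ_{d ∈ Δ} a?d.τ_C(∂_c(Q^{ac} ∥ (1 + b!d.Q^{cb})))`,
where `c` is the third port, `y = Q^{ac}` and `z = Q^{cb}`. -/
noncomputable def queueBody (Δ : Finset 𝔻) (a b c : C) (x y z : QueueVar) :
    BCP A C (Option 𝔻) QueueVar :=
  .alt .emp (.alt (.pre (some (.send b none)) (.var x))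
    (.sum (Δ.toList.map fun d => .pre (some (.recv a (some d)))
      (.hide (.encap c (.par (.var y)
        (.alt .emp (.pre (some (.send b (some d))) (.var z)))))))))

/-- The recursive specification of the queue, with auxiliary port `l`. -/
noncomputable def queueSpec (Δ : Finset 𝔻) (i o l : C) : QueueVar → BCP A C (Option 𝔻) QueueVar
  | .io => queueBody Δ i o l .io .il .lo
  | .il => queueBody Δ i l o .il .io .ol
  | .lo => queueBody Δ l o i .lo .li .io
  | .ol => queueBody Δ o l i .ol .oi .il
  | .li => queueBody Δ l i o .li .lo .oi
  | .oi => queueBody Δ o i l .oi .ol .li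

/-- The process graph of the process identifier `Q^{io}` of the queue specification. -/
noncomputable def queueProc (A : Type*) {C : Type*} {𝔻 : Type*} (Δ : Finset 𝔻) (i o l : C) :
    ProcessGraph (BCP A C (Option 𝔻) QueueVar) (Act A C (Option 𝔻)) :=
  BCP.graph (queueSpec Δ i o l) (.var .io)

end Queue

end QueueTheory

open QueueTheory

namespace QueueTheory

/-! ### Branching bisimilarity: composition, congruence, restriction of labels -/

namespace ProcessGraph

universe u₁ u₂ u₃ v₁

section General

variable {S : Type u₁} {T : Type u₂} {U : Type u₃} {L : Type v₁}

/-! A queue can hold a Turing tape written cyclically: read from the head of the queue, first the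
symbols to the right of the tape head, from the head outwards, then a separator, then the symbols to
the left, from the far end inwards. The scanned symbol and the machine state live in the finite
control. Enqueuing puts a symbol immediately to the left of the tape head, and dequeuing takes the
one immediately to its right, so a move to the right is cheap. A move to the left needs the symbol
enqueued last: the control enqueues a mark followed by the new symbol and rotates the queue up to
the mark, always holding one symbol back. The symbol held when the mark appears is the wanted one
(`settles_hold`, `settles_left`). Dequeuing or holding the separator shows that this half of the
stored tape is exhausted and a blank is due (`settles_move`).

Between two `run` states the control only talks to the queue. These steps become silent, and the
queue contents decide each dequeuing, so the system is deterministic there (`system_deterministic`).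
A system state is therefore related to every machine configuration represented by a `run` state to
which it settles: silent steps on the way are matched by idling, and all choices are made in `run`
states. This gives `graph_restrict_bisimilar_system`. Machine transitions that could interfere with
the queue ports are dropped beforehand, which the hypothesis on `p` permits
(`BranchingBisimilar.restrict`).

For the algebraic queue, a state of `Q^{ab}` is a tree of linked smaller queues, whose contents are
read off by `Holds`. It may send `ε` although data are still waiting in its front part, so it
matches the automaton only once `o!ε` is removed. The control never receives `ε`, so this removal
changes nothing after encapsulation, and congruence transfers the result. -/

theorem Transfer.tauSteps {G : ProcessGraph S L} {H : ProcessGraph T L} {R : S → T → Prop}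
    (h : Transfer G H R) {s s' : S} (hs : G.TauSteps s s') :
    ∀ {t}, R s t → ∃ t', H.TauSteps t t' ∧ R s' t' := by
  induction hs with
  | refl => exact fun {t} ht => ⟨t, .refl, ht⟩
  | tail _ hstep ih =>
    intro t ht
    obtain ⟨t₁, ht₁, hR⟩ := ih ht
    obtain ⟨t₂, t₃, h₂, h₃ | ⟨-, rfl⟩, -, hR'⟩ := h.step _ _ hR _ _ hstep
    · exact ⟨t₃, ht₁.trans (h₂.tail h₃), hR'⟩
    · exact ⟨t₂, ht₁.trans h₂, hR'⟩

/-- The transfer condition constrains only the state just before the action, not the earlier ones on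
the silent path. Hence that path can be followed in the third graph by `Transfer.tauSteps` before
the action itself is matched. -/
theorem Transfer.comp {G : ProcessGraph S L} {H : ProcessGraph T L} {K : ProcessGraph U L}
    {R : S → T → Prop} {R' : T → U → Prop} (h : Transfer G H R) (h' : Transfer H K R') :
    Transfer G K (fun s u => ∃ t, R s t ∧ R' t u) where
  step := by
    rintro s u ⟨t, hst, htu⟩ a s' hs
    obtain ⟨t₂, t₃, h₂, h₃, hR₂, hR₃⟩ := h.step _ _ hst _ _ hs
    obtain ⟨u₁, hu₁, hR₁⟩ := h'.tauSteps h₂ htu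
    obtain h₃ | ⟨rfl, rfl⟩ := h₃
    · obtain ⟨u₂, u₃, k₂, k₃, hK₂, hK₃⟩ := h'.step _ _ hR₁ _ _ h₃
      exact ⟨u₂, u₃, hu₁.trans k₂, k₃, ⟨_, hR₂, hK₂⟩, ⟨_, hR₃, hK₃⟩⟩
    · exact ⟨u₁, u₁, hu₁, .inr ⟨rfl, rfl⟩, ⟨_, hR₂, hR₁⟩, ⟨_, hR₃, hR₁⟩⟩
  final := by
    rintro s u ⟨t, hst, htu⟩ hs
    obtain ⟨t₁, h₁, hf⟩ := h.final _ _ hst hs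
    obtain ⟨u₁, hu₁, hR₁⟩ := h'.tauSteps h₁ htu
    obtain ⟨u₂, hu₂, hf'⟩ := h'.final _ _ hR₁ hf
    exact ⟨u₂, hu₁.trans hu₂, hf'⟩

theorem BranchingBisimilar.trans {G : ProcessGraph S L} {H : ProcessGraph T L}
    {K : ProcessGraph U L} (h : G.BranchingBisimilar H) (h' : H.BranchingBisimilar K) :
    G.BranchingBisimilar K := by
  obtain ⟨R, h₁, h₂, h₃⟩ := h
  obtain ⟨R', h₁', h₂', h₃'⟩ := h'
  refine ⟨_, h₁.comp h₁', ?_, _, h₃, h₃'⟩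
  simpa only [and_comm] using h₂'.comp h₂

/-- The process graph with all steps removed whose action does not satisfy `keep`. -/
def restrict (G : ProcessGraph S L) (keep : L → Prop) : ProcessGraph S L where
  step s a t := G.step s a t ∧ ∀ b, a = some b → keep b
  root := G.root
  final := G.final

theorem TauSteps.restrict {G : ProcessGraph S L} {s t : S} (h : G.TauSteps s t)
    (keep : L → Prop) : (G.restrict keep).TauSteps s t :=
  Relation.ReflTransGen.mono (fun _ _ h => ⟨h, by simp⟩) _ _ h

/-- Restricting the relation to pairs with a reachable left state suffices: a matching step carries
the same label as the step of `G`, hence a permitted one, and silent steps always survive. -/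
theorem BranchingBisimilar.restrict {G : ProcessGraph S L} {H : ProcessGraph T L}
    (h : G.BranchingBisimilar H) (keep : L → Prop)
    (hG : ∀ s a t, G.Reachable G.root s → G.step s (some a) t → keep a) :
    G.BranchingBisimilar (H.restrict keep) := by
  obtain ⟨R, h₁, h₂, h₃⟩ := h
  have tau : ∀ {s t}, G.TauSteps s t → G.Reachable s t := fun h => Relation.ReflTransGen.mono (fun _ _ h => ⟨_, h⟩) _ _ h
  refine ⟨fun s t => R s t ∧ G.Reachable G.root s, ⟨?_, ?_⟩, ⟨?_, ?_⟩, h₃, .refl⟩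
  · rintro s t ⟨hR, hs⟩ a s' hstep
    obtain ⟨t₁, t₂, k₁, k₂, hR₁, hR₂⟩ := h₁.step _ _ hR _ _ hstep
    refine ⟨t₁, t₂, k₁.restrict keep, k₂.imp (fun k => ⟨k, ?_⟩) id, ⟨hR₁, hs⟩,
      hR₂, hs.tail ⟨_, hstep⟩⟩
    rintro b rfl
    exact hG _ _ _ hs hstep
  · rintro s t ⟨hR, hs⟩ hf
    obtain ⟨t', k, hf'⟩ := h₁.final _ _ hR hf
    exact ⟨t', k.restrict keep, hf'⟩
  · rintro t s ⟨hR, hs⟩ a t' ⟨hstep, -⟩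
    obtain ⟨s₁, s₂, k₁, k₂, hR₁, hR₂⟩ := h₂.step _ _ hR _ _ hstep
    have hs₁ := hs.trans (tau k₁)
    refine ⟨s₁, s₂, k₁, k₂, ⟨hR₁, hs₁⟩, hR₂, ?_⟩
    obtain k₂ | ⟨-, rfl⟩ := k₂
    · exact hs₁.tail ⟨_, k₂⟩
    · exact hs₁
  · rintro t s ⟨hR, -⟩ hf
    exact h₂.final _ _ hR hf

end General

/-! ### Congruence for parallel composition, encapsulation and abstraction. -/

section Congruence

variable {A : Type*} {C : Type*} {M : Type*} {S : Type*} {T : Type*} {U : Type*}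
  {H : ProcessGraph T (Act A C M)} {K : ProcessGraph U (Act A C M)} {R : T → U → Prop}

theorem TauSteps.parRight (G : ProcessGraph S (Act A C M)) {t t' : T} (h : H.TauSteps t t')
    (s : S) : (G.par H).TauSteps (s, t) (s, t') :=
  Relation.ReflTransGen.lift (r := fun t t' => H.step t none t') (fun t => (s, t))
    (fun _ _ h => .right s h) _ _ h

theorem TauSteps.encap {t t' : T} (h : H.TauSteps t t') (c : C) : (H.encap c).TauSteps t t' :=
  Relation.ReflTransGen.mono (fun _ _ h => ⟨h, by simp⟩) _ _ h

theorem TauSteps.hide {t t' : T} (h : H.TauSteps t t') : H.hide.TauSteps t t' :=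
  Relation.ReflTransGen.mono (fun _ _ h => .inl ⟨h, by simp⟩) _ _ h

theorem Transfer.parRight (h : Transfer H K R) (G : ProcessGraph S (Act A C M)) :
    Transfer (G.par H) (G.par K) (fun x y => x.1 = y.1 ∧ R x.2 y.2) where
  step := by
    rintro ⟨s, t⟩ ⟨_, u⟩ ⟨rfl, hR⟩ a x' hstep
    have key : ∀ {b t'}, H.step t b t' → ∃ u'' u', K.TauSteps u u'' ∧ K.OptStep u'' b u' ∧
      R t u'' ∧ R t' u' := fun h' => h.step _ _ hR _ _ h'
    cases hstep with
    | left _ hs => exact ⟨(s, u), (_, u), .refl, .inl (.left _ hs), ⟨rfl, hR⟩, rfl, hR⟩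
    | right _ ht =>
      obtain ⟨u₁, u₂, k₁, k₂, hR₁, hR₂⟩ := key ht
      refine ⟨(s, u₁), (s, u₂), k₁.parRight G s, ?_, ⟨rfl, hR₁⟩, rfl, hR₂⟩
      exact k₂.imp (.right s) fun ⟨h, h'⟩ => ⟨h, by rw [h']⟩
    | sendRecv hs ht =>
      obtain ⟨u₁, u₂, k₁, k₂ | ⟨h, -⟩, hR₁, hR₂⟩ := key ht
      · exact ⟨(s, u₁), (_, u₂), k₁.parRight G s, .inl (.sendRecv hs k₂), ⟨rfl, hR₁⟩, rfl, hR₂⟩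
      -- A synchronising action is visible, so it cannot be matched by idling.
      · cases h
    | recvSend hs ht =>
      obtain ⟨u₁, u₂, k₁, k₂ | ⟨h, -⟩, hR₁, hR₂⟩ := key ht
      · exact ⟨(s, u₁), (_, u₂), k₁.parRight G s, .inl (.recvSend hs k₂), ⟨rfl, hR₁⟩, rfl, hR₂⟩
      · cases h
  final := by
    rintro ⟨s, t⟩ ⟨_, u⟩ ⟨rfl, hR⟩ ⟨hs, ht⟩
    obtain ⟨u', k, hu⟩ := h.final _ _ hR ht
    exact ⟨(s, u'), k.parRight G s, hs, hu⟩

theorem Transfer.encap (h : Transfer H K R) (c : C) : Transfer (H.encap c) (K.encap c) R where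
  step := by
    rintro t u hR a t' ⟨hstep, ha⟩
    obtain ⟨u₁, u₂, k₁, k₂, hR'⟩ := h.step _ _ hR _ _ hstep
    exact ⟨u₁, u₂, k₁.encap c, k₂.imp (fun k => ⟨k, ha⟩) id, hR'⟩
  final := by
    intro t u hR ht
    obtain ⟨u', k, hu⟩ := h.final _ _ hR ht
    exact ⟨u', k.encap c, hu⟩

theorem Transfer.hide (h : Transfer H K R) : Transfer H.hide K.hide R where
  step := by
    rintro t u hR a t' (⟨hstep, ha⟩ | ⟨rfl, c, m, hstep⟩)
    · obtain ⟨u₁, u₂, k₁, k₂, hR'⟩ := h.step _ _ hR _ _ hstep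
      exact ⟨u₁, u₂, k₁.hide, k₂.imp (fun k => .inl ⟨k, ha⟩) id, hR'⟩
    · obtain ⟨u₁, u₂, k₁, k₂ | ⟨h, -⟩, hR'⟩ := h.step _ _ hR _ _ hstep
      · exact ⟨u₁, u₂, k₁.hide, .inl (.inr ⟨rfl, c, m, k₂⟩), hR'⟩
      · cases h
  final := by
    intro t u hR ht
    obtain ⟨u', k, hu⟩ := h.final _ _ hR ht
    exact ⟨u', k.hide, hu⟩

theorem BranchingBisimilar.parRight (h : H.BranchingBisimilar K)
    (G : ProcessGraph S (Act A C M)) : (G.par H).BranchingBisimilar (G.par K) := by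
  obtain ⟨R, h₁, h₂, h₃⟩ := h
  refine ⟨_, h₁.parRight G, ?_, rfl, h₃⟩
  simpa only [eq_comm] using h₂.parRight G

theorem BranchingBisimilar.encap (h : H.BranchingBisimilar K) (c : C) :
    (H.encap c).BranchingBisimilar (K.encap c) := by
  obtain ⟨R, h₁, h₂, h₃⟩ := h
  exact ⟨R, h₁.encap c, h₂.encap c, h₃⟩

theorem BranchingBisimilar.hide (h : H.BranchingBisimilar K) :
    H.hide.BranchingBisimilar K.hide := by
  obtain ⟨R, h₁, h₂, h₃⟩ := h
  exact ⟨R, h₁.hide, h₂.hide, h₃⟩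

/-- A message that the left component never receives may be removed from the right one. -/
theorem par_restrict_send_encap {G : ProcessGraph S (Act A C M)} {c : C} {m : M}
    (hG : ∀ s s', ¬ G.step s (some (.recv c m)) s') :
    (G.par (H.restrict (· ≠ .send c m))).encap c = (G.par H).encap c := by
  have key : ∀ x a y, ((G.par (H.restrict (· ≠ .send c m))).encap c).step x a y ↔
      ((G.par H).encap c).step x a y := by
    rintro x a y
    constructor
    · rintro ⟨h, ha⟩
      refine ⟨?_, ha⟩
      cases h with
      | left _ h => exact .left _ h
      | right _ h => exact .right _ h.1
      | sendRecv h h' => exact .sendRecv h h'.1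
      | recvSend h h' => exact .recvSend h h'.1
    · rintro ⟨h, ha⟩
      refine ⟨?_, ha⟩
      cases h with
      | left _ h => exact .left _ h
      | right _ h =>
        -- An unsynchronised `c!m` is blocked by the encapsulation anyway; a synchronised one would
        -- need `c?m` from `G`.
        refine .right _ ⟨h, ?_⟩
        rintro b rfl rfl
        exact (ha m).1 rfl
      | sendRecv h h' => exact .sendRecv h ⟨h', by rintro _ ⟨⟩ ⟨⟩⟩
      | recvSend h h' =>
        refine .recvSend h ⟨h', ?_⟩
        rintro _ ⟨⟩ ⟨⟩
        exact hG _ _ h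
  have : ((G.par (H.restrict (· ≠ .send c m))).encap c).step = ((G.par H).encap c).step := by
    funext x a y
    exact propext (key x a y)
  exact congrArg (fun st => ProcessGraph.mk st (G.root, H.root)
    (fun x => G.final x.1 ∧ H.final x.2)) this

end Congruence

end ProcessGraph

end QueueTheory

namespace QueueTheory

/-! ### The specification of the queue by process expressions -/

section QueueSpec

variable {A : Type*} {C : Type*} {𝔻 : Type*}

/-- The input port of an identifier. -/
def QueueVar.src (i o l : C) : QueueVar → C
  | io => i | il => i | lo => l | ol => o | li => l | oi => o

/-- The output port of an identifier. -/
def QueueVar.dst (i o l : C) : QueueVar → C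
  | io => o | il => l | lo => o | ol => l | li => i | oi => i

/-- The port that is neither the input nor the output port of an identifier. -/
def QueueVar.aux (i o l : C) : QueueVar → C
  | io => l | il => o | lo => i | ol => i | li => o | oi => l

/-- The identifier from the input port to the auxiliary port. -/
def QueueVar.front : QueueVar → QueueVar
  | io => il | il => io | lo => li | ol => oi | li => lo | oi => ol

/-- The identifier from the auxiliary port to the output port. -/
def QueueVar.back : QueueVar → QueueVar
  | io => lo | il => ol | lo => io | ol => il | li => oi | oi => li

open QueueVar

/-- The six equations are one scheme up to permuting the ports. As the components of a queue are
queues for other identifiers, inductions have to treat all identifiers uniformly. -/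
theorem queueSpec_eq (Δ : Finset 𝔻) (i o l : C) (v : QueueVar) :
    queueSpec (A := A) Δ i o l v =
      queueBody Δ (v.src i o l) (v.dst i o l) (v.aux i o l) v v.front v.back := by
  cases v <;> rfl

theorem BCP.step_sum_iff {M X : Type*} {Γ : X → BCP A C M X} {ps : List (BCP A C M X)}
    {a : Option (Act A C M)} {p' : BCP A C M X} :
    BCP.Step Γ (BCP.sum ps) a p' ↔ ∃ p ∈ ps, BCP.Step Γ p a p' := by
  induction ps with
  | nil =>
    simp only [BCP.sum, List.foldr_nil, List.not_mem_nil, false_and, exists_false, iff_false]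
    rintro ⟨⟩
  | cons q ps ih =>
    simp only [List.mem_cons, exists_eq_or_imp, ← ih]
    refine ⟨fun h => ?_, fun h => h.elim (.altLeft _) (.altRight _)⟩
    cases h with
    | altLeft _ h => exact .inl h
    | altRight _ h => exact .inr h

/-- The term `τ(∂_c(p ∥ q))`. -/
def pipe {M X : Type*} (c : C) (p q : BCP A C M X) : BCP A C M X := .hide (.encap c (.par p q))

/-- The term `1 + c!d.Q`. -/
def cell {X : Type*} (c : C) (d : 𝔻) (v : X) : BCP A C (Option 𝔻) X :=
  .alt .emp (.pre (some (.send c (some d))) (.var v))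

/-! ### Transitions of two processes linked at an encapsulated port -/

section Pipe

variable {M X : Type*} {Γ : X → BCP A C M X} {c : C} {p p' q q' : BCP A C M X}
  {a : Option (Act A C M)}

theorem pipe_step_inv {r : BCP A C M X} (h : BCP.Step Γ (pipe c p q) a r) :
    (∃ p', BCP.Step Γ p a p' ∧ (∀ m, a ≠ some (.send c m) ∧ a ≠ some (.recv c m)) ∧
      r = pipe c p' q) ∨
    (∃ q', BCP.Step Γ q a q' ∧ (∀ m, a ≠ some (.send c m) ∧ a ≠ some (.recv c m)) ∧
      r = pipe c p q') ∨
    (a = none ∧ ∃ b m p' q', r = pipe c p' q' ∧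
      ((BCP.Step Γ p (some (.comm b m)) p' ∧ q' = q) ∨
       (BCP.Step Γ q (some (.comm b m)) q' ∧ p' = p) ∨
       (BCP.Step Γ p (some (.send b m)) p' ∧ BCP.Step Γ q (some (.recv b m)) q') ∨
       (BCP.Step Γ p (some (.recv b m)) p' ∧ BCP.Step Γ q (some (.send b m)) q'))) := by
  cases h with
  | hideComm h =>
    refine .inr (.inr ⟨rfl, ?_⟩)
    cases h with
    | encap h _ =>
      cases h with
      | parLeft _ h => exact ⟨_, _, _, _, rfl, .inl ⟨h, rfl⟩⟩
      | parRight _ h => exact ⟨_, _, _, _, rfl, .inr (.inl ⟨h, rfl⟩)⟩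
      | sendRecv h h' => exact ⟨_, _, _, _, rfl, .inr (.inr (.inl ⟨h, h'⟩))⟩
      | recvSend h h' => exact ⟨_, _, _, _, rfl, .inr (.inr (.inr ⟨h, h'⟩))⟩
  | hideOther h hc =>
    cases h with
    | encap h he =>
      cases h with
      | parLeft _ h => exact .inl ⟨_, h, he, rfl⟩
      | parRight _ h => exact .inr (.inl ⟨_, h, he, rfl⟩)
      | sendRecv h h' => exact absurd rfl (hc _ _)
      | recvSend h h' => exact absurd rfl (hc _ _)

theorem pipe_step_left (h : BCP.Step Γ p a p')
    (hc : ∀ m, a ≠ some (.send c m) ∧ a ≠ some (.recv c m)) (ha : ∀ b m, a ≠ some (.comm b m)) :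
    BCP.Step Γ (pipe c p q) a (pipe c p' q) :=
  .hideOther (.encap (.parLeft _ h) hc) ha

theorem pipe_step_right (h : BCP.Step Γ q a q')
    (hc : ∀ m, a ≠ some (.send c m) ∧ a ≠ some (.recv c m)) (ha : ∀ b m, a ≠ some (.comm b m)) :
    BCP.Step Γ (pipe c p q) a (pipe c p q') :=
  .hideOther (.encap (.parRight _ h) hc) ha

theorem pipe_step_comm {b : C} {m : M} (h : BCP.Step Γ p (some (.send b m)) p')
    (h' : BCP.Step Γ q (some (.recv b m)) q') :
    BCP.Step Γ (pipe c p q) none (pipe c p' q') :=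
  .hideComm (.encap (.sendRecv h h') (by simp))

/-- Finitely many `τ`-steps of expressions. -/
def BCP.TauSteps (Γ : X → BCP A C M X) : BCP A C M X → BCP A C M X → Prop :=
  Relation.ReflTransGen fun p q => BCP.Step Γ p none q

theorem pipe_tauSteps_left (h : BCP.TauSteps Γ p p') :
    BCP.TauSteps Γ (pipe c p q) (pipe c p' q) :=
  Relation.ReflTransGen.lift (r := fun p q => BCP.Step Γ p none q) (fun p => pipe c p q)
    (fun _ _ h => pipe_step_left h (by simp) (by simp)) _ _ h

theorem pipe_tauSteps_right (h : BCP.TauSteps Γ q q') :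
    BCP.TauSteps Γ (pipe c p q) (pipe c p q') :=
  Relation.ReflTransGen.lift (r := fun p q => BCP.Step Γ p none q) (fun q => pipe c p q)
    (fun _ _ h => pipe_step_right h (by simp) (by simp)) _ _ h

end Pipe

theorem queueVar_step_iff {Δ : Finset 𝔻} {i o l : C} {v : QueueVar}
    {a : Option (Act A C (Option 𝔻))} {p' : BCP A C (Option 𝔻) QueueVar} :
    BCP.Step (queueSpec Δ i o l) (.var v) a p' ↔
      (a = some (.send (v.dst i o l) none) ∧ p' = .var v) ∨
      ∃ d : Δ, a = some (.recv (v.src i o l) (some d.1)) ∧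
        p' = pipe (v.aux i o l) (.var v.front) (cell (v.dst i o l) d.1 v.back) := by
  constructor
  · intro h
    cases h with
    | var h =>
      rw [queueSpec_eq] at h
      cases h with
      | altLeft _ h => cases h
      | altRight _ h =>
        cases h with
        | altLeft _ h =>
          cases h
          exact .inl ⟨rfl, rfl⟩
        | altRight _ h =>
          obtain ⟨p, hp, h⟩ := BCP.step_sum_iff.1 h
          obtain ⟨d, hd, rfl⟩ := List.mem_map.1 hp
          cases h
          exact .inr ⟨⟨d, Finset.mem_toList.1 hd⟩, rfl, rfl⟩
  · intro h
    refine .var ?_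
    rw [queueSpec_eq]
    obtain ⟨rfl, rfl⟩ | ⟨d, rfl, rfl⟩ := h
    · exact .altRight _ (.altLeft _ (.pre _ _))
    · exact .altRight _ (.altRight _ (BCP.step_sum_iff.2
        ⟨_, List.mem_map.2 ⟨d.1, Finset.mem_toList.2 d.2, rfl⟩, .pre _ _⟩))

theorem cell_step_iff {X : Type*} {Γ : X → BCP A C (Option 𝔻) X} {c : C} {d : 𝔻} {v : X}
    {a : Option (Act A C (Option 𝔻))} {p' : BCP A C (Option 𝔻) X} :
    BCP.Step Γ (cell c d v) a p' ↔ a = some (.send c (some d)) ∧ p' = .var v := by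
  constructor
  · intro h
    cases h with
    | altLeft _ h => cases h
    | altRight _ h =>
      cases h
      exact ⟨rfl, rfl⟩
  · rintro ⟨rfl, rfl⟩
    exact .altRight _ (.pre _ _)

/-- `Holds i o l v p ζ`: the expression `p` is a state of the queue `v` with contents `ζ`. -/
inductive Holds {Δ : Finset 𝔻} (i o l : C) :
    QueueVar → BCP A C (Option 𝔻) QueueVar → List Δ → Prop
  | var (v) : Holds i o l v (.var v) []
  | cell {v p ζ} (d : Δ) : Holds i o l (front v) p ζ →
      Holds i o l v (pipe (v.aux i o l) p (cell (v.dst i o l) d.1 v.back)) (ζ ++ [d])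
  | pipe {v p q ζ ξ} : Holds i o l (front v) p ζ → Holds i o l (back v) q ξ →
      Holds i o l v (pipe (v.aux i o l) p q) (ζ ++ ξ)

theorem Holds.final {Δ : Finset 𝔻} {i o l : C} {v : QueueVar}
    {p : BCP A C (Option 𝔻) QueueVar} {ζ : List Δ} (h : Holds i o l v p ζ) :
    BCP.Final (queueSpec Δ i o l) p := by
  induction h with
  | var v =>
    refine .var ?_
    rw [queueSpec_eq]
    exact .altLeft _ .emp
  | cell d _ ih => exact .hide (.encap _ (.par ih (.altLeft _ .emp)))
  | pipe _ _ ih ih' => exact .hide (.encap _ (.par ih ih'))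

@[simp] theorem src_front (i o l : C) (v : QueueVar) : v.front.src i o l = v.src i o l := by
  cases v <;> rfl

@[simp] theorem dst_front (i o l : C) (v : QueueVar) : v.front.dst i o l = v.aux i o l := by
  cases v <;> rfl

@[simp] theorem src_back (i o l : C) (v : QueueVar) : v.back.src i o l = v.aux i o l := by
  cases v <;> rfl

@[simp] theorem dst_back (i o l : C) (v : QueueVar) : v.back.dst i o l = v.dst i o l := by
  cases v <;> rfl

/-- The three ports are distinct. -/
structure Distinct (i o l : C) : Prop where
  io : i ≠ o
  li : l ≠ i
  lo : l ≠ o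

variable {Δ : Finset 𝔻} {i o l : C}

theorem Distinct.ne (h : Distinct i o l) (v : QueueVar) :
    v.src i o l ≠ v.aux i o l ∧ v.dst i o l ≠ v.aux i o l ∧ v.src i o l ≠ v.dst i o l := by
  obtain ⟨h₁, h₂, h₃⟩ := h
  cases v <;> simp only [src, dst, aux] <;> tauto

/-- The steps that a state of the queue `v` with contents `ζ` can do. -/
theorem Holds.step_inv (hd : Distinct i o l) {v : QueueVar}
    {p : BCP A C (Option 𝔻) QueueVar} {ζ : List Δ} (h : Holds i o l v p ζ) :
    ∀ {a p'}, BCP.Step (queueSpec Δ i o l) p a p' →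
      ((a = none ∨ a = some (.send (v.dst i o l) none)) ∧ Holds i o l v p' ζ) ∨
      (∃ d : Δ, a = some (.recv (v.src i o l) (some d.1)) ∧ Holds i o l v p' (d :: ζ)) ∨
      (∃ (d : Δ) (ζ' : _), a = some (.send (v.dst i o l) (some d.1)) ∧ ζ = ζ' ++ [d] ∧
        Holds i o l v p' ζ') := by
  induction h with
  | var v =>
    intro a p' h
    obtain ⟨rfl, rfl⟩ | ⟨d, rfl, rfl⟩ := queueVar_step_iff.1 h
    · exact .inl ⟨.inr rfl, .var v⟩
    · exact .inr (.inl ⟨d, rfl, .cell (ζ := []) d (.var _)⟩)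
  | @cell v p ζ d hp ih =>
    intro a r hs
    have h₃ := (hd.ne v).2.2
    obtain ⟨p', h, hc, rfl⟩ | ⟨q', h, hc, rfl⟩ | ⟨rfl, b, m, p', q', rfl, hm⟩ := pipe_step_inv hs
    · obtain ⟨rfl | rfl, k⟩ | ⟨e, rfl, k⟩ | ⟨e, ζ', rfl, rfl, k⟩ := ih h
      · exact .inl ⟨.inl rfl, .cell d k⟩
      · simp at hc
      · exact .inr (.inl ⟨e, by simp, .cell d k⟩)
      · simp at hc
    · obtain ⟨rfl, rfl⟩ := cell_step_iff.1 h
      refine .inr (.inr ⟨d, ζ, rfl, rfl, ?_⟩)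
      simpa using Holds.pipe hp (.var (back v))
    · exfalso
      obtain ⟨h, -⟩ | ⟨h, -⟩ | ⟨-, h⟩ | ⟨h, h'⟩ := hm
      · simpa using ih h
      · simpa using cell_step_iff.1 h
      · simpa using cell_step_iff.1 h
      -- The front receives only at the source port and the cell sends only at the destination port;
      -- these differ.
      · have h₄ := ih h
        have h₅ := cell_step_iff.1 h'
        simp only [reduceCtorEq, Option.some.injEq, Act.send.injEq, Act.recv.injEq, false_and,
          exists_false, or_self, or_false, false_or] at h₄ h₅
        obtain ⟨e, ⟨h₄, -⟩, -⟩ := h₄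
        exact h₃ ((src_front i o l v).symm.trans (h₄.symm.trans h₅.1.1))
  | @pipe v p q ζ ξ hp hq ihp ihq =>
    intro a r hs
    have h₃ := (hd.ne v).2.2
    obtain ⟨p', h, hc, rfl⟩ | ⟨q', h, hc, rfl⟩ | ⟨rfl, b, m, p', q', rfl, hm⟩ := pipe_step_inv hs
    · obtain ⟨rfl | rfl, k⟩ | ⟨e, rfl, k⟩ | ⟨e, ζ', rfl, rfl, k⟩ := ihp h
      · exact .inl ⟨.inl rfl, .pipe k hq⟩
      · simp at hc
      · exact .inr (.inl ⟨e, by simp, .pipe k hq⟩)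
      · simp at hc
    · obtain ⟨rfl | rfl, k⟩ | ⟨e, rfl, k⟩ | ⟨e, ξ', rfl, rfl, k⟩ := ihq h
      · exact .inl ⟨.inl rfl, .pipe hp k⟩
      -- Here `ε` may be sent although the front part is nonempty, which is why the first
      -- alternative allows it for arbitrary contents.
      · exact .inl ⟨.inr (by simp), .pipe hp k⟩
      · simp at hc
      · exact .inr (.inr ⟨e, ζ ++ ξ', by simp, by simp, .pipe hp k⟩)
    · obtain ⟨h, -⟩ | ⟨h, -⟩ | ⟨h, h'⟩ | ⟨h, h'⟩ := hm
      · simpa using ihp h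
      · simpa using ihq h
      · have h₄ := ihp h
        have h₅ := ihq h'
        simp only [reduceCtorEq, Option.some.injEq, Act.send.injEq, Act.recv.injEq, false_and,
          exists_false, or_self, or_false, false_or] at h₄ h₅
        obtain ⟨e', ⟨-, rfl⟩, k'⟩ := h₅
        -- The front's `ε` finds no receiver, since the back accepts only data. What remains is a
        -- datum crossing from front to back, which leaves the concatenated contents unchanged.
        obtain ⟨⟨-, ⟨⟩⟩, -⟩ | ⟨e, ζ', ⟨-, he⟩, rfl, k⟩ := h₄
        obtain rfl : e' = e := Subtype.ext (Option.some.inj he)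
        refine .inl ⟨.inl rfl, ?_⟩
        simpa using Holds.pipe k k'
      · exfalso
        have h₄ := ihp h
        have h₅ := ihq h'
        simp only [reduceCtorEq, Option.some.injEq, Act.send.injEq, Act.recv.injEq, false_and,
          exists_false, or_self, or_false, false_or] at h₄ h₅
        obtain ⟨e, ⟨h₄, -⟩, -⟩ := h₄
        refine h₃ ((src_front i o l v).symm.trans (h₄.symm.trans ?_))
        rw [← dst_back]
        exact h₅.elim (fun h => h.1.1) fun ⟨_, _, h, _⟩ => h.1

/-- The state `p` of the queue `v` can deliver `d`, after which the contents are `ζ`. -/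
def Delivers (i o l : C) (v : QueueVar) (p : BCP A C (Option 𝔻) QueueVar) (d : Δ)
    (ζ : List Δ) : Prop :=
  ∃ p₁ p₂, BCP.TauSteps (queueSpec Δ i o l) p p₁ ∧ Holds i o l v p₁ (ζ ++ [d]) ∧
    BCP.Step (queueSpec Δ i o l) p₁ (some (.send (v.dst i o l) (some d.1))) p₂ ∧
    Holds i o l v p₂ ζ

theorem Delivers.pipe_right (hd : Distinct i o l) {v : QueueVar}
    {p q : BCP A C (Option 𝔻) QueueVar} {d : Δ} {ζ ξ : List Δ}
    (hp : Holds i o l v.front p ζ) (hq : Delivers i o l v.back q d ξ) :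
    Delivers i o l v (pipe (v.aux i o l) p q) d (ζ ++ ξ) := by
  obtain ⟨q₁, q₂, h₁, h₂, h₃, h₄⟩ := hq
  refine ⟨_, pipe (v.aux i o l) p q₂, pipe_tauSteps_right h₁, ?_, ?_, .pipe hp h₄⟩
  · simpa using Holds.pipe hp h₂
  · rw [dst_back] at h₃
    exact pipe_step_right h₃ (by simpa using (hd.ne v).2.1) (by simp)

/-- The datum crosses the auxiliary port by a hidden communication and is then passed on by the back
part. -/
theorem Delivers.pipe_left (hd : Distinct i o l) {v : QueueVar}
    {p q q' : BCP A C (Option 𝔻) QueueVar} {d : Δ} {ζ : List Δ}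
    (hp : Delivers i o l v.front p d ζ)
    (hq : BCP.Step (queueSpec Δ i o l) q (some (.recv (v.aux i o l) (some d.1))) q')
    (hq' : Delivers i o l v.back q' d []) :
    Delivers i o l v (pipe (v.aux i o l) p q) d ζ := by
  obtain ⟨p₁, p₂, h₁, -, h₃, h₄⟩ := hp
  rw [dst_front] at h₃
  obtain ⟨r₁, r₂, k₁, k⟩ := hq'.pipe_right hd h₄
  rw [List.append_nil] at k
  exact ⟨r₁, r₂, ((pipe_tauSteps_left h₁).tail (pipe_step_comm h₃ hq)).trans k₁, k⟩

/-- A queue accepts all data, delivers the head if it is nonempty, and if it is empty delivers a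
datum just accepted. -/
theorem Holds.accepts_delivers (hd : Distinct i o l) {v : QueueVar}
    {p : BCP A C (Option 𝔻) QueueVar} {ζ : List Δ} (h : Holds i o l v p ζ) :
    (∀ d, ∃ p', BCP.Step (queueSpec Δ i o l) p (some (.recv (v.src i o l) (some d.1))) p' ∧
      Holds i o l v p' (d :: ζ) ∧ (ζ = [] → Delivers i o l v p' d [])) ∧
    ∀ ζ' d, ζ = ζ' ++ [d] → Delivers i o l v p d ζ' := by
  -- The clause for empty contents in the statement is needed because an empty back part must
  -- deliver a datum that it has just accepted: its state after acceptance is no subterm, so the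
  -- induction hypothesis would say nothing about its deliveries.
  have send_cell : ∀ {v : QueueVar} {p : BCP A C (Option 𝔻) QueueVar} {ζ : List Δ} (d : Δ),
      Holds i o l v.front p ζ →
        Delivers i o l v (QueueTheory.pipe (v.aux i o l) p
          (QueueTheory.cell (v.dst i o l) d.1 v.back)) d ζ := by
    intro v p ζ d hp
    refine ⟨_, QueueTheory.pipe (v.aux i o l) p (.var v.back), .refl, .cell d hp,
      pipe_step_right (cell_step_iff.2 ⟨rfl, rfl⟩) (by simpa using (hd.ne v).2.1) (by simp), ?_⟩
    simpa using Holds.pipe hp (.var v.back)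
  induction h with
  | var v =>
    refine ⟨fun d => ⟨_, queueVar_step_iff.2 (.inr ⟨d, rfl, rfl⟩), ?_, fun _ => ?_⟩, by simp⟩
    · exact .cell (ζ := []) d (.var _)
    · exact send_cell d (.var _)
  | @cell v p ζ d hp ih =>
    refine ⟨fun e => ?_, fun ζ' e he => ?_⟩
    · obtain ⟨p', h₁, h₂, -⟩ := ih.1 e
      rw [src_front] at h₁
      exact ⟨_, pipe_step_left h₁ (by simpa using (hd.ne v).1) (by simp), .cell d h₂, by simp⟩
    · obtain ⟨rfl, h⟩ := List.append_inj' he rfl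
      obtain rfl : d = e := by simpa using h
      exact send_cell d hp
  | @pipe v p q ζ ξ hp hq ihp ihq =>
    refine ⟨fun e => ?_, fun ζ' e he => ?_⟩
    · obtain ⟨p', h₁, h₂, h₃⟩ := ihp.1 e
      rw [src_front] at h₁
      refine ⟨_, pipe_step_left h₁ (by simpa using (hd.ne v).1) (by simp), .pipe h₂ hq, ?_⟩
      intro h
      obtain ⟨rfl, rfl⟩ := List.append_eq_nil_iff.1 h
      obtain ⟨q', k₁, -, k₃⟩ := ihq.1 e
      rw [src_back] at k₁
      exact (h₃ rfl).pipe_left hd k₁ (k₃ rfl)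
    · obtain rfl | ⟨ξ', e', rfl⟩ := List.eq_nil_or_concat' ξ
      · rw [List.append_nil] at he
        obtain ⟨q', k₁, -, k₃⟩ := ihq.1 e
        rw [src_back] at k₁
        exact (ihp.2 _ _ he).pipe_left hd k₁ (k₃ rfl)
      · rw [← List.append_assoc] at he
        obtain ⟨rfl, h⟩ := List.append_inj' he rfl
        obtain rfl : e' = e := by simpa using h
        exact (ihq.2 _ _ rfl).pipe_right hd hp

/-- The steps of the queue automaton. -/
theorem queueAutomaton_step_iff (hΔ : Δ.Nonempty) {x y : Unit × List Δ}
    {a : Option (Act A C (Option 𝔻))} :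
    (queueAutomaton A i o Δ hΔ).graph.step x a y ↔
      (∃ d : Δ, a = some (.recv i (some d.1)) ∧ y.2 = d :: x.2) ∨
      (∃ d : Δ, a = some (.send o (some d.1)) ∧ x.2 = y.2 ++ [d]) ∨
      (a = some (.send o none) ∧ x.2 = [] ∧ y.2 = []) := by
  obtain ⟨⟨⟩, ζ⟩ := x
  obtain ⟨⟨⟩, ζ'⟩ := y
  constructor
  · intro h
    cases h with
    | empty h =>
      simp only [queueAutomaton, queueTrans] at h
      simp at h
      aesop
    | deq _ h =>
      simp only [queueAutomaton, queueTrans] at h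
      simp at h
      aesop
    | star _ h =>
      simp only [queueAutomaton, queueTrans] at h
      simp at h
      aesop
  · rintro (⟨d, rfl, h⟩ | ⟨d, rfl, h⟩ | ⟨rfl, h, h'⟩)
    · obtain rfl : ζ' = d :: ζ := h
      exact .star (δ := [d]) ζ (.inl (.inl ⟨d, rfl⟩))
    · obtain rfl : ζ = ζ' ++ [d] := h
      exact .deq (δ := []) ζ' (.inl (.inr ⟨d, rfl⟩))
    · obtain rfl : ζ = [] := h
      obtain rfl : ζ' = [] := h'
      exact .empty (.inr rfl)

/-- Without the signal `o!ε`, the queue automaton and the process `Q^{io}` are branching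
bisimilar. -/
theorem queueAutomaton_bisimilar_queueProc (hd : Distinct i o l) (hΔ : Δ.Nonempty) :
    ((queueAutomaton A i o Δ hΔ).graph.restrict (· ≠ .send o none)).BranchingBisimilar
      ((queueProc A Δ i o l).restrict (· ≠ .send o none)) := by
  refine ⟨fun x p => Holds i o l .io p x.2, ⟨?_, ?_⟩, ⟨?_, ?_⟩, .var _⟩
  · rintro ⟨⟨⟩, ζ⟩ p hp a ⟨⟨⟩, ζ'⟩ ⟨h, ha⟩
    obtain ⟨d, rfl, k⟩ | ⟨d, rfl, k⟩ | ⟨rfl, -⟩ := (queueAutomaton_step_iff hΔ).1 h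
    · obtain rfl : ζ' = d :: ζ := k
      obtain ⟨p', h₁, h₂, -⟩ := (hp.accepts_delivers hd).1 d
      exact ⟨p, p', .refl, .inl ⟨h₁, ha⟩, hp, h₂⟩
    · obtain rfl : ζ = ζ' ++ [d] := k
      obtain ⟨p₁, p₂, h₁, h₂, h₃, h₄⟩ := (hp.accepts_delivers hd).2 _ _ rfl
      exact ⟨p₁, p₂, ProcessGraph.TauSteps.restrict (G := queueProc A Δ i o l) h₁ _,
        .inl ⟨h₃, ha⟩, h₂, h₄⟩
    · exact absurd rfl (ha _ rfl)
  · exact fun x p hp _ => ⟨p, .refl, hp.final⟩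
  · rintro p ⟨⟨⟩, ζ⟩ hp a p' ⟨h, ha⟩
    obtain ⟨rfl | rfl, k⟩ | ⟨d, rfl, k⟩ | ⟨d, ζ', rfl, h', k⟩ := hp.step_inv hd h
    -- Internal transport of data is invisible to the automaton.
    · exact ⟨_, _, .refl, .inr ⟨rfl, rfl⟩, hp, k⟩
    · exact absurd rfl (ha _ rfl)
    · exact ⟨_, ((), d :: ζ), .refl,
        .inl ⟨(queueAutomaton_step_iff hΔ).2 (.inl ⟨d, rfl, rfl⟩), ha⟩, hp, k⟩
    · exact ⟨_, ((), ζ'), .refl,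
        .inl ⟨(queueAutomaton_step_iff hΔ).2 (.inr (.inl ⟨d, rfl, h'⟩)), ha⟩, hp, k⟩
  · exact fun p x _ _ => ⟨x, .refl, trivial⟩

/-- A process that does not use the signal `o?ε` cannot distinguish the queues. -/
theorem par_queueAutomaton_bisimilar_par_queueProc (hd : Distinct i o l) (hΔ : Δ.Nonempty)
    {S : Type*} {q : ProcessGraph S (Act A C (Option 𝔻))}
    (hq : ∀ s s', ¬ q.step s (some (.recv o none)) s') :
    (((q.par (queueAutomaton A i o Δ hΔ).graph).encap o).encap i).hide.BranchingBisimilar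
      (((q.par (queueProc A Δ i o l)).encap o).encap i).hide := by
  rw [← ProcessGraph.par_restrict_send_encap hq,
    ← ProcessGraph.par_restrict_send_encap (H := queueProc A Δ i o l) hq]
  exact ((((queueAutomaton_bisimilar_queueProc hd hΔ).parRight q).encap o).encap i).hide

end QueueSpec
end QueueTheory

namespace QueueTheory

/-! ### Simulation of a reactive Turing machine by a finite process with a queue -/

section Simulation

/-- The symbols stored in the queue: tape symbols, and two separators. -/
inductive QueueSym (D : Type) where
  | tape (x : Option D)
  /-- between the contents of the tape to the right and to the left of the head -/
  | sep
  /-- the point up to which the queue is rotated -/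
  | mark

/-- The states of the finite control. In `run`, the control knows the symbol under the head;
in all other states a next state of this form is determined. -/
inductive Control (S D : Type) where
  | init
  | run (s : S) (x : Option D)
  | right (s : S) (x : Option D)
  | pop (s : S)
  | extend (s : S)
  | left (s : S) (x : QueueSym D)
  | insert (s : S) (x : QueueSym D)
  | first (s : S)
  | hold (s : S) (x : QueueSym D)
  | emit (s : S) (x y : QueueSym D)
  | restore (s : S)

/-- The first state after a move in a given direction, having written `x`. -/
def Control.move {S D : Type} : Turing.Dir → S → Option D → Control S D
  | .left, s, x => .left s (.tape x)
  | .right, s, x => .right s x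

/-- These are the states in which the control stands for a complete configuration and the machine's
own transitions take place. -/
inductive Control.IsRun {S D : Type} : Control S D → Prop
  | run (s x) : IsRun (run s x)

instance {D : Type} [Finite D] : Finite (QueueSym D) := by
  refine Finite.of_surjective (α := Option D ⊕ Unit ⊕ Unit)
    (Sum.elim .tape (Sum.elim (fun _ => .sep) fun _ => .mark)) ?_
  rintro (x | _ | _)
  exacts [⟨.inl x, rfl⟩, ⟨.inr (.inl ()), rfl⟩, ⟨.inr (.inr ()), rfl⟩]

instance {S D : Type} [Finite S] [Finite D] : Finite (Control S D) := by
  have h : (Set.univ : Set (Control S D)) ⊆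
      {.init} ∪ Set.range (fun y : S × Option D => .run y.1 y.2) ∪
      Set.range (fun y : S × Option D => .right y.1 y.2) ∪ Set.range .pop ∪ Set.range .extend ∪
      Set.range (fun y : S × QueueSym D => .left y.1 y.2) ∪
      Set.range (fun y : S × QueueSym D => .insert y.1 y.2) ∪ Set.range .first ∪
      Set.range (fun y : S × QueueSym D => .hold y.1 y.2) ∪
      Set.range (fun y : S × QueueSym D × QueueSym D => .emit y.1 y.2.1 y.2.2) ∪
      Set.range .restore := by
    rintro (_ | _ | _ | _ | _ | _ | _ | _ | _ | _ | _) - <;> simp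
  refine Set.finite_univ_iff.1 (Set.Finite.subset ?_ h)
  simp only [Set.finite_union]
  simp [Set.finite_range]

variable {A C 𝔻 : Type*} {S D : Type}

/-- The action that enqueues `x`. -/
def enq (i : C) (enc : QueueSym D → 𝔻) (x : QueueSym D) : Option (Act A C (Option 𝔻)) :=
  some (.send i (some (enc x)))

/-- The action that dequeues `x`. -/
def deq (o : C) (enc : QueueSym D → 𝔻) (x : QueueSym D) : Option (Act A C (Option 𝔻)) :=
  some (.recv o (some (enc x)))

/-- The steps of the finite control. -/
inductive ControlStep (M : RTM S (Act A C (Option 𝔻)) D) (i o : C) (enc : QueueSym D → 𝔻) :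
    Control S D → Option (Act A C (Option 𝔻)) → Control S D → Prop
  | init : ControlStep M i o enc .init (enq i enc .sep) (.run M.root none)
  | run {s a d e m t} : (s, a, d, e, m, t) ∈ M.trans → (∀ b, a = some b → b.Avoids i o) →
      ControlStep M i o enc (.run s d) a (.move m t e)
  | right (s e) : ControlStep M i o enc (.right s e) (enq i enc (.tape e)) (.pop s)
  | pop (s x) : ControlStep M i o enc (.pop s) (deq o enc (.tape x)) (.run s x)
  | popSep (s) : ControlStep M i o enc (.pop s) (deq o enc .sep) (.extend s)
  -- The right half was empty and its separator has just been removed. A blank is enqueued so that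
  -- the rotation for a left move, with the separator as inserted symbol, puts the separator back at
  -- the head of the queue and returns this blank.
  | extend (s) : ControlStep M i o enc (.extend s) (enq i enc (.tape none)) (.left s .sep)
  | left (s x) : ControlStep M i o enc (.left s x) (enq i enc .mark) (.insert s x)
  | insert (s x) : ControlStep M i o enc (.insert s x) (enq i enc x) (.first s)
  | first (s x) : ControlStep M i o enc (.first s) (deq o enc x) (.hold s x)
  | hold (s x y) : y ≠ .mark → ControlStep M i o enc (.hold s x) (deq o enc y) (.emit s x y)
  | emit (s x y) : ControlStep M i o enc (.emit s x y) (enq i enc x) (.hold s y)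
  | holdMark (s x) : ControlStep M i o enc (.hold s (.tape x)) (deq o enc .mark) (.run s x)
  | holdSep (s) : ControlStep M i o enc (.hold s .sep) (deq o enc .mark) (.restore s)
  -- The symbol taken from the end was the separator, so the left half is empty: the separator goes
  -- back and the scanned symbol is blank.
  | restore (s) : ControlStep M i o enc (.restore s) (enq i enc .sep) (.run s none)

/-- The process graph of the finite control. -/
def controlGraph (M : RTM S (Act A C (Option 𝔻)) D) (i o : C) (enc : QueueSym D → 𝔻) :
    ProcessGraph (Control S D) (Act A C (Option 𝔻)) where
  step := ControlStep M i o enc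
  root := .init
  final k := ∃ s x, k = .run s x ∧ s ∈ M.final

variable {M : RTM S (Act A C (Option 𝔻)) D} {i o : C} {enc : QueueSym D → 𝔻}

/-- Machine steps never touch the queue ports, and bookkeeping steps do nothing else. Thus, beside
the queue, the former cannot synchronise and the latter must. -/
theorem ControlStep.label {k k' : Control S D} {a : Option (Act A C (Option 𝔻))}
    (h : ControlStep M i o enc k a k') :
    (k.IsRun ∧ ∀ b, a = some b → b.Avoids i o) ∨
      ¬ k.IsRun ∧ ((∃ x, a = enq i enc x) ∨ ∃ x, a = deq o enc x) := by
  cases h with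
  | run h ha => exact .inl ⟨.run _ _, ha⟩
  | _ => exact .inr ⟨nofun, by first | exact .inl ⟨_, rfl⟩ | exact .inr ⟨_, rfl⟩⟩

/-- Outside the states `run s x`, a choice is possible only between dequeuing different
symbols. -/
theorem ControlStep.deterministic {k k₁ k₂ : Control S D} {a b : Option (Act A C (Option 𝔻))}
    (hk : ¬ k.IsRun) (h₁ : ControlStep M i o enc k a k₁) (h₂ : ControlStep M i o enc k b k₂) :
    (a = b ∧ k₁ = k₂) ∨ ∃ u v, a = deq o enc u ∧ b = deq o enc v ∧ u ≠ v := by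
  cases h₁ with
  | run => exact absurd (.run _ _) hk
  | pop s x =>
    cases h₂ with
    | pop s y =>
      obtain rfl | h := eq_or_ne x y
      · exact .inl ⟨rfl, rfl⟩
      · exact .inr ⟨_, _, rfl, rfl, by simpa using h⟩
    | popSep => exact .inr ⟨_, _, rfl, rfl, nofun⟩
  | popSep =>
    cases h₂ with
    | pop s y => exact .inr ⟨_, _, rfl, rfl, nofun⟩
    | popSep => exact .inl ⟨rfl, rfl⟩
  | first s x =>
    cases h₂ with
    | first s y =>
      obtain rfl | h := eq_or_ne x y
      · exact .inl ⟨rfl, rfl⟩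
      · exact .inr ⟨_, _, rfl, rfl, h⟩
  | hold s x y hy =>
    cases h₂ with
    | hold s x z hz =>
      obtain rfl | h := eq_or_ne y z
      · exact .inl ⟨rfl, rfl⟩
      · exact .inr ⟨_, _, rfl, rfl, h⟩
    | holdMark => exact .inr ⟨_, _, rfl, rfl, hy⟩
    | holdSep => exact .inr ⟨_, _, rfl, rfl, hy⟩
  | holdMark =>
    cases h₂ with
    | hold s x z hz => exact .inr ⟨_, _, rfl, rfl, hz.symm⟩
    | holdMark => exact .inl ⟨rfl, rfl⟩
  | holdSep =>
    cases h₂ with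
    | hold s x z hz => exact .inr ⟨_, _, rfl, rfl, hz.symm⟩
    | holdSep => exact .inl ⟨rfl, rfl⟩
  | _ =>
    cases h₂
    exact .inl ⟨rfl, rfl⟩

theorem controlGraph_isFinite : (controlGraph M i o enc).IsFinite := by
  have := M.finite_states
  have := M.finite_data
  refine ⟨show Finite (Control S D) from inferInstance, ?_⟩
  have hl : ((fun x : S × Option (Act A C (Option 𝔻)) × Option D × Option D × Turing.Dir × S =>
      x.2.1) '' M.trans ∪ Set.range (enq i enc) ∪ Set.range (deq o enc)).Finite :=
    ((M.finite_trans.image _).union (Set.finite_range _)).union (Set.finite_range _)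
  refine (Set.finite_univ.prod (hl.prod Set.finite_univ)).subset ?_
  rintro ⟨k, a, k'⟩ (h : ControlStep M i o enc k a k')
  simp only [Set.mem_prod, Set.mem_univ, true_and, and_true]
  cases h with
  | run h => exact .inl (.inl ⟨_, h, rfl⟩)
  | _ => first | exact .inl (.inr ⟨_, rfl⟩) | exact .inr ⟨_, rfl⟩

/-- Exhausted halves of the tape are recognised by the separator, so the emptiness signal is never
consulted. -/
theorem controlGraph_not_recv_none (s s' : Control S D) :
    ¬ (controlGraph M i o enc).step s (some (.recv o none)) s' := by
  intro h
  obtain ⟨-, h⟩ | ⟨-, ⟨x, h⟩ | ⟨x, h⟩⟩ := ControlStep.label h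
  · exact (h _ rfl).2 rfl
  · simp [enq] at h
  · simp [deq] at h

/-! ### The control coupled to the queue -/

variable {Δ : Finset 𝔻} (hΔ : Δ.Nonempty) (henc : ∀ x, enc x ∈ Δ)

variable (M i o enc) in
/-- The finite control together with the queue. -/
def system : ProcessGraph (Control S D × Unit × List Δ) (Act A C (Option 𝔻)) :=
  ((((controlGraph M i o enc).par (queueAutomaton A i o Δ hΔ).graph).encap o).encap i).hide

/-- The state of the system with control `k` and queue contents `w`, the first symbol of which
is at the head of the queue. -/
def conf (k : Control S D) (w : List (QueueSym D)) : Control S D × Unit × List Δ :=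
  (k, (), (w.map fun x => ⟨enc x, henc x⟩).reverse)

/-- Every action of the queue is at port `i` or `o` and hence blocked on its own. So the system
moves either by a machine step, with the queue fixed, or by a hidden communication transferring one
symbol. -/
theorem system_step_inv (hio : i ≠ o) {x y : Control S D × Unit × List Δ}
    {a : Option (Act A C (Option 𝔻))} (h : (system M i o enc hΔ).step x a y) :
    (x.1.IsRun ∧ ControlStep M i o enc x.1 a y.1 ∧ x.2 = y.2) ∨
    ¬ x.1.IsRun ∧ a = none ∧
      ((∃ z, ControlStep M i o enc x.1 (enq i enc z) y.1 ∧ y.2.2 = ⟨enc z, henc z⟩ :: x.2.2) ∨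
       ∃ z, ControlStep M i o enc x.1 (deq o enc z) y.1 ∧ x.2.2 = y.2.2 ++ [⟨enc z, henc z⟩]) := by
  obtain ⟨⟨⟨h, h₁⟩, h₂⟩, h₃⟩ | ⟨rfl, c, m, ⟨h, h₁⟩, h₂⟩ := h
  · cases h with
    | left _ h =>
      obtain ⟨hr, h'⟩ | ⟨hr, ⟨z, rfl⟩ | ⟨z, rfl⟩⟩ := ControlStep.label h
      · exact .inl ⟨hr, h, rfl⟩
      · exact absurd rfl (h₂ _).1
      · exact absurd rfl (h₁ _).2
    | right _ h =>
      obtain ⟨d, rfl, -⟩ | ⟨d, rfl, -⟩ | ⟨rfl, -⟩ := (queueAutomaton_step_iff hΔ).1 h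
      · exact absurd rfl (h₂ _).2
      · exact absurd rfl (h₁ _).1
      · exact absurd rfl (h₁ _).1
    | sendRecv _ _ => exact absurd rfl (h₃ _ _)
    | recvSend _ _ => exact absurd rfl (h₃ _ _)
  · cases h with
    | left _ h =>
      obtain ⟨-, h'⟩ | ⟨-, ⟨z, h'⟩ | ⟨z, h'⟩⟩ := ControlStep.label h
      · exact (h' _ rfl).elim
      · simp [enq] at h'
      · simp [deq] at h'
    | right _ h => simpa using (queueAutomaton_step_iff hΔ).1 h
    | sendRecv h h' =>
      have k := (queueAutomaton_step_iff hΔ).1 h'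
      simp only [reduceCtorEq, Option.some.injEq, Act.recv.injEq, false_and, exists_false,
        or_false] at k
      obtain ⟨d, ⟨rfl, rfl⟩, k⟩ := k
      obtain ⟨-, hl⟩ | ⟨hr, ⟨z, hl⟩ | ⟨z, hl⟩⟩ := ControlStep.label h
      · exact ((hl _ rfl).1 rfl).elim
      · refine .inr ⟨hr, rfl, .inl ⟨z, hl ▸ h, k.trans ?_⟩⟩
        simp only [enq, Option.some.injEq, Act.send.injEq, true_and] at hl
        rw [Subtype.ext (a1 := d) (a2 := ⟨enc z, henc z⟩) hl]
      · simp [deq] at hl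
    | recvSend h h' =>
      obtain ⟨-, hl⟩ | ⟨hr, ⟨z, hl⟩ | ⟨z, hl⟩⟩ := ControlStep.label h
      · have k := (queueAutomaton_step_iff hΔ).1 h'
        simp only [reduceCtorEq, Option.some.injEq, Act.send.injEq, false_and, exists_false,
          false_or] at k
        obtain ⟨d, ⟨rfl, -⟩, -⟩ | ⟨⟨rfl, -⟩, -⟩ := k
        · exact ((hl _ rfl).2 rfl).elim
        · exact ((hl _ rfl).2 rfl).elim
      · simp [enq] at hl
      · have hl' := hl
        simp only [deq, Option.some.injEq, Act.recv.injEq] at hl'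
        obtain ⟨rfl, rfl⟩ := hl'
        have k := (queueAutomaton_step_iff hΔ).1 h'
        simp only [reduceCtorEq, Option.some.injEq, Act.send.injEq, false_and, exists_false,
          false_or, and_false, or_false, true_and] at k
        obtain ⟨d, hz, k⟩ := k
        refine .inr ⟨hr, rfl, .inr ⟨z, h, k.trans ?_⟩⟩
        rw [Subtype.ext (a1 := d) (a2 := ⟨enc z, henc z⟩) hz.symm]

theorem system_step_run {k k' : Control S D} {w : List (QueueSym D)}
    {a : Option (Act A C (Option 𝔻))} (h : ControlStep M i o enc k a k') (hk : k.IsRun) :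
    (system M i o enc hΔ).step (conf henc k w) a (conf henc k' w) := by
  obtain ⟨-, ha⟩ | ⟨hk', -⟩ := h.label
  · refine .inl ⟨⟨⟨.left _ h, ?_⟩, ?_⟩, ?_⟩
    · rintro m
      constructor <;> rintro rfl
      exacts [(ha _ rfl).2 rfl, (ha _ rfl).2 rfl]
    · rintro m
      constructor <;> rintro rfl
      exacts [(ha _ rfl).1 rfl, (ha _ rfl).1 rfl]
    · rintro c m rfl
      exact ha _ rfl
  · exact absurd hk hk'

theorem system_step_enq {k k' : Control S D} (w : List (QueueSym D)) {z : QueueSym D}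
    (h : ControlStep M i o enc k (enq i enc z) k') :
    (system M i o enc hΔ).step (conf henc k w) none (conf henc k' (w ++ [z])) := by
  refine .inr ⟨rfl, i, _, ⟨.sendRecv h ((queueAutomaton_step_iff hΔ).2
    (.inl ⟨⟨enc z, henc z⟩, rfl, ?_⟩)), by simp⟩, by simp⟩
  simp

theorem system_step_deq {k k' : Control S D} {w : List (QueueSym D)} {z : QueueSym D}
    (h : ControlStep M i o enc k (deq o enc z) k') :
    (system M i o enc hΔ).step (conf henc k (z :: w)) none (conf henc k' w) := by
  refine .inr ⟨rfl, o, _, ⟨.recvSend h ((queueAutomaton_step_iff hΔ).2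
    (.inr (.inl ⟨⟨enc z, henc z⟩, rfl, ?_⟩))), by simp⟩, by simp⟩
  simp

/-- Outside the states `run s x`, the system is deterministic. -/
theorem system_deterministic (henc : ∀ x, enc x ∈ Δ) (hio : i ≠ o) (hinj : enc.Injective)
    {x y z : Control S D × Unit × List Δ} {a : Option (Act A C (Option 𝔻))} (hx : ¬ x.1.IsRun)
    (hy : (system M i o enc hΔ).step x none y) (hz : (system M i o enc hΔ).step x a z) :
    a = none ∧ y = z := by
  obtain ⟨h, -⟩ | ⟨-, -, ky⟩ := system_step_inv hΔ henc hio hy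
  · exact absurd h hx
  obtain ⟨h, -⟩ | ⟨-, rfl, kz⟩ := system_step_inv hΔ henc hio hz
  · exact absurd h hx
  refine ⟨rfl, ?_⟩
  obtain ⟨k, ⟨⟩, ζ⟩ := x
  obtain ⟨k₁, ⟨⟩, ζ₁⟩ := y
  obtain ⟨k₂, ⟨⟩, ζ₂⟩ := z
  obtain ⟨u, hu, hu'⟩ | ⟨u, hu, hu'⟩ := ky <;> obtain ⟨v, hv, hv'⟩ | ⟨v, hv, hv'⟩ := kz <;>
    obtain ⟨hl, hk⟩ | ⟨u', v', hl, hl', hne⟩ := hu.deterministic hx hv <;>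
    simp only [enq, deq, Option.some.injEq, Act.send.injEq, Act.recv.injEq, true_and,
      reduceCtorEq] at * <;> subst_vars
  · simp_all
  · obtain ⟨rfl, -⟩ := List.append_inj' hv' rfl
    rfl
  -- Two different symbols would both have to be at the head of the queue, contradicting injectivity
  -- of the encoding.
  · have h := List.append_inj' hv' rfl
    exact absurd (by simpa [hl, hl'] using h.2) (hinj.ne hne)

/-- Finitely many `τ`-steps of the system from states not of the form `run s x`. -/
def Settles (M : RTM S (Act A C (Option 𝔻)) D) (i o : C) (enc : QueueSym D → 𝔻)
    (hΔ : Δ.Nonempty) : Control S D × Unit × List Δ → Control S D × Unit × List Δ → Prop :=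
  Relation.ReflTransGen fun x y => ¬ x.1.IsRun ∧ (system M i o enc hΔ).step x none y

theorem Settles.tauSteps {x y : Control S D × Unit × List Δ} (h : Settles M i o enc hΔ x y) :
    (system M i o enc hΔ).TauSteps x y :=
  Relation.ReflTransGen.mono (fun _ _ h => h.2) _ _ h

theorem settles_enq {k k' : Control S D} {w : List (QueueSym D)} (z : QueueSym D)
    (h : ControlStep M i o enc k (enq i enc z) k') (hk : ¬ k.IsRun) {y}
    (hy : Settles M i o enc hΔ (conf henc k' (w ++ [z])) y) :
    Settles M i o enc hΔ (conf henc k w) y :=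
  .head ⟨hk, system_step_enq hΔ henc w h⟩ hy

theorem settles_deq {k k' : Control S D} {w : List (QueueSym D)} {z : QueueSym D}
    (h : ControlStep M i o enc k (deq o enc z) k') (hk : ¬ k.IsRun) {y}
    (hy : Settles M i o enc hΔ (conf henc k' w) y) :
    Settles M i o enc hΔ (conf henc k (z :: w)) y :=
  .head ⟨hk, system_step_deq hΔ henc h⟩ hy

/-- The queue is rotated up to the mark, with the exception of the symbol just before it. -/
theorem settles_hold {s : S} {u : List (QueueSym D)} (hu : .mark ∉ u) {y} :
    ∀ {x z v t}, x :: u = z ++ [t] →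
      Settles M i o enc hΔ (conf henc (.hold s t) (.mark :: (v ++ z))) y →
      Settles M i o enc hΔ (conf henc (.hold s x) (u ++ .mark :: v)) y := by
  induction u with
  | nil =>
    intro x z v t h hy
    obtain ⟨rfl, h⟩ := List.append_inj' (s₁ := []) h rfl
    obtain rfl : x = t := by simpa using h
    simpa using hy
  | cons x' u ih =>
    intro x z v t h hy
    simp only [List.mem_cons, not_or] at hu
    cases z with
    | nil => simp at h
    | cons z₀ z =>
      simp only [List.cons_append, List.cons.injEq] at h
      obtain ⟨rfl, h⟩ := h
      refine settles_deq hΔ henc (.hold s x x' (Ne.symm hu.1)) nofun ?_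
      refine settles_enq hΔ henc x (.emit s x x') nofun ?_
      -- The symbol given up by the control joins the part behind the mark.
      have := ih hu.2 (v := v ++ [x]) h (by simpa using hy)
      simpa using this

/-- The last symbol `t` is taken from the queue, and `x` is added at the head. -/
theorem settles_left {s : S} {x t : QueueSym D} {z : List (QueueSym D)}
    (hz : .mark ∉ z ++ [t]) {y}
    (hy : Settles M i o enc hΔ (conf henc (.hold s t) (.mark :: x :: z)) y) :
    Settles M i o enc hΔ (conf henc (.left s x) (z ++ [t])) y := by
  refine settles_enq hΔ henc _ (.left s x) nofun ?_
  refine settles_enq hΔ henc _ (.insert s x) nofun ?_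
  obtain ⟨x₀, u, h⟩ : ∃ x₀ u, z ++ [t] = x₀ :: u := List.exists_cons_of_ne_nil (by simp)
  have hu : .mark ∉ u := fun hu => hz (by rw [h]; exact List.mem_cons_of_mem _ hu)
  have := settles_hold (M := M) (i := i) (o := o) hΔ henc (s := s) hu (v := [x]) h.symm hy
  rw [h]
  refine settles_deq hΔ henc (.first s x₀) nofun ?_
  simpa using this

/-- The contents of the queue that represent the tape to the left and to the right of the head,
both given from the head outwards. -/
def contents (l r : List (Option D)) : List (QueueSym D) :=
  r.map .tape ++ .sep :: (l.map .tape).reverse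

theorem mark_notMem_contents (l r : List (Option D)) : .mark ∉ contents l r := by
  simp [contents]

/-- The system state `x` represents the machine configuration `c`. -/
def Represents (henc : ∀ x, enc x ∈ Δ) (c : S × Turing.Tape (Option D))
    (x : Control S D × Unit × List Δ) : Prop :=
  ∃ l r, c.2.left = .mk l ∧ c.2.right = .mk r ∧ x = conf henc (.run c.1 c.2.head) (contents l r)

theorem settles_move (m : Turing.Dir) (s : S) (e : Option D) (T : Turing.Tape (Option D))
    {l r : List (Option D)} (hl : T.left = .mk l) (hr : T.right = .mk r) :
    ∃ y, Represents henc (s, (T.write e).move m) y ∧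
      Settles M i o enc hΔ (conf henc (.move m s e) (contents l r)) y := by
  obtain ⟨h, L, R⟩ := T
  obtain rfl : L = .mk l := hl
  obtain rfl : R = .mk r := hr
  cases m with
  | left =>
    cases l with
    | nil =>
      -- The left half is all blank, so the rotation ends holding the separator.
      refine ⟨_, ⟨[], e :: r, rfl, rfl, rfl⟩, ?_⟩
      refine settles_left hΔ henc (mark_notMem_contents [] r) ?_
      refine settles_deq hΔ henc (.holdSep s) nofun ?_
      exact settles_enq hΔ henc _ (.restore s) nofun .refl
    | cons x l =>
      refine ⟨_, ⟨l, e :: r, rfl, rfl, rfl⟩, ?_⟩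
      have hc : contents (x :: l) r = contents l r ++ [.tape x] := by simp [contents]
      rw [hc]
      refine settles_left hΔ henc (by simpa using mark_notMem_contents l r) ?_
      exact settles_deq hΔ henc (.holdMark s x) nofun .refl
  | right =>
    have hc : ∀ r, contents l r ++ [.tape e] = contents (e :: l) r := by simp [contents]
    cases r with
    | nil =>
      refine ⟨_, ⟨e :: l, [], rfl, rfl, rfl⟩, ?_⟩
      refine settles_enq hΔ henc _ (.right s e) nofun ?_
      rw [hc]
      refine settles_deq hΔ henc (.popSep s) nofun ?_
      refine settles_enq hΔ henc _ (.extend s) nofun ?_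
      -- At this point the queue holds the left half followed by the auxiliary blank, with no
      -- separator.
      refine settles_left hΔ henc (by simp) ?_
      exact settles_deq hΔ henc (.holdMark s none) nofun .refl
    | cons x r =>
      refine ⟨_, ⟨e :: l, r, rfl, rfl, rfl⟩, ?_⟩
      refine settles_enq hΔ henc _ (.right s e) nofun ?_
      rw [hc]
      exact settles_deq hΔ henc (.pop s x) nofun .refl

/-- A reactive Turing machine, restricted to actions that do not interfere with the queue, is
branching bisimilar to the finite control together with the queue. -/
theorem graph_restrict_bisimilar_system (henc : ∀ x, enc x ∈ Δ) (hio : i ≠ o) (hinj : enc.Injective) :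
    (M.graph.restrict (Act.Avoids i o)).BranchingBisimilar (system M i o enc hΔ) := by
  have stable : ∀ {c y x}, Represents henc c y → Settles M i o enc hΔ x y →
      x.1.IsRun → x = y := by
    intro c y x _ h hx
    obtain rfl | ⟨_, h, -⟩ := Relation.ReflTransGen.cases_head h
    · rfl
    · exact absurd hx h.1
  refine ⟨fun c x => ∃ y, Represents henc c y ∧ Settles M i o enc hΔ x y,
    ⟨?_, ?_⟩, ⟨?_, ?_⟩, ?_⟩
  · rintro ⟨s, T⟩ x ⟨y, ⟨l, r, hl, hr, rfl⟩, hx⟩ a ⟨s', T'⟩ ⟨⟨e, m, h, hT'⟩, ha⟩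
    obtain rfl : T' = (T.write e).move m := hT'
    exact ⟨_, _, hx.tauSteps,
      .inl (system_step_run hΔ henc (ControlStep.run h ha) (.run _ _)),
      ⟨_, ⟨l, r, hl, hr, rfl⟩, .refl⟩, settles_move hΔ henc m s' e T hl hr⟩
  · rintro ⟨s, T⟩ x ⟨y, ⟨l, r, hl, hr, rfl⟩, hx⟩ hs
    exact ⟨_, hx.tauSteps, ⟨_, _, rfl, hs⟩, trivial⟩
  · rintro x ⟨s, T⟩ ⟨y, hy, hx⟩ a x' hstep
    -- Either the system is in the representing `run` state, and its step is a machine step, or it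
    -- is on its way there. In the latter case determinism makes the step the next one on that way,
    -- and the machine idles.
    obtain rfl | ⟨x₁, ⟨hr, h₁⟩, h₂⟩ := Relation.ReflTransGen.cases_head hx
    · obtain ⟨l, r, hl, hr, rfl⟩ := hy
      obtain ⟨-, h, hq⟩ | ⟨h, -⟩ := system_step_inv hΔ henc hio hstep
      · obtain ⟨k', q'⟩ := x'
        obtain rfl : _ = q' := hq
        cases h with
        | @run _ _ _ e m t h ha =>
          exact ⟨(s, T), (t, (T.write e).move m), .refl, .inl ⟨⟨e, m, h, rfl⟩, ha⟩,
            ⟨_, ⟨l, r, hl, hr, rfl⟩, hx⟩, settles_move hΔ henc m t e T hl hr⟩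
      · exact absurd (.run _ _) h
    · obtain ⟨rfl, rfl⟩ := system_deterministic hΔ henc hio hinj hr h₁ hstep
      exact ⟨_, _, .refl, .inr ⟨rfl, rfl⟩, ⟨y, hy, hx⟩, y, hy, h₂⟩
  · rintro x ⟨s, T⟩ ⟨y, hy, hx⟩ ⟨⟨s', d, hk, hs⟩, -⟩
    refine ⟨(s, T), .refl, ?_⟩
    obtain rfl := stable hy hx (by rw [hk]; exact .run _ _)
    obtain ⟨l, r, -, -, rfl⟩ := hy
    simp only [conf, Control.run.injEq] at hk
    obtain ⟨rfl, -⟩ := hk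
    exact hs
  -- The blank tape is represented by the separator alone, which the control enqueues at the start.
  · refine ⟨_, ⟨[], [], rfl, rfl, rfl⟩, ?_⟩
    exact settles_enq hΔ henc (w := []) _ .init nofun .refl

end Simulation

end QueueTheory

theorem mainTheorem4 {A C 𝔻 P : Type*} [Infinite 𝔻] (i o : C) (hio : i ≠ o)
    (p : ProcessGraph P (Act A C (Option 𝔻))) (hp : p.IsExecutable)
    (hports : ∀ s a t, p.Reachable p.root s → p.step s (some a) t → a.Avoids i o) :
    (∃ (Δ : Finset 𝔻) (hΔ : Δ.Nonempty) (S : Type) (q : ProcessGraph S (Act A C (Option 𝔻))),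
      q.IsFinite ∧
      p.BranchingBisimilar
        (((q.par (queueAutomaton A i o Δ hΔ).graph).encap o).encap i).hide) ∧
    (∀ l : C, l ≠ i → l ≠ o →
      ∃ (Δ : Finset 𝔻) (S : Type) (q : ProcessGraph S (Act A C (Option 𝔻))),
        Δ.Nonempty ∧ q.IsFinite ∧
        p.BranchingBisimilar (((q.par (queueProc A Δ i o l)).encap o).encap i).hide) := by
  obtain ⟨S, D, M, hM⟩ := hp
  have := M.finite_data
  -- The finitely many queue symbols are encoded by distinct data, as `𝔻` is infinite; `Δ` is the
  -- set of codes.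
  obtain ⟨enc⟩ : Nonempty (QueueSym D ↪ 𝔻) :=
    ⟨(Finite.equivFin (QueueSym D)).toEmbedding.trans
      (Fin.valEmbedding.trans (Infinite.natEmbedding 𝔻))⟩
  let Δ : Finset 𝔻 := (Set.finite_range enc).toFinset
  have henc : ∀ x, enc x ∈ Δ := fun x => (Set.finite_range enc).mem_toFinset.2 ⟨x, rfl⟩
  have hΔ : Δ.Nonempty := ⟨_, henc .sep⟩
  have h := (hM.restrict _ hports).trans
    (graph_restrict_bisimilar_system (M := M) hΔ henc hio enc.injective)
  exact ⟨⟨Δ, hΔ, _, controlGraph M i o enc, controlGraph_isFinite, h⟩, fun l hli hlo =>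
    ⟨Δ, _, controlGraph M i o enc, hΔ, controlGraph_isFinite,
      h.trans (par_queueAutomaton_bisimilar_par_queueProc ⟨hio, hli, hlo⟩ hΔ
        controlGraph_not_recv_none)⟩⟩
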